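/- Let $N,n$ be natural numbers and let $\mathcal G$ be a weighted signed directed graph on the vertices $\{1,\dots,N\}$ with real weights $w_{ij}$ such that $w_{ii}=0$ and $w_{ij}w_{ji}\ge 0$ for all $i,j$; there is an edge from $j$ to $i$ exactly when $w_{ij}\neq 0$. Let $L=[l_{ij}]$ be its Laplacian, $l_{ii}=\sum_j|w_{ij}|$ and $l_{ij}=-w_{ij}$ for $i\ne j$. Let $A\in\mathbf R^{n\times n}$, $\Lambda=I_n-A$, $h>0$, $0\le\sigma\le1$, and consider for $i=1,\dots,N$ the opinion dynamics $$\dot x_i(t)=Ax_i(t)+\sigma\Lambda u_i(t)+(1-\sigma)\Lambda u_i(t-h),\qquad t\ge 0,$$ where $u_i$ is locally integrable on $[-h,\infty)$ with arbitrary history on $[-h,0)$, $x_i$ is continuous on $[0,\infty)$ and the equation is understood in the integrated (Carathéodory) sense, under the memory communication rule $$u_i(t)=F\sum_{j=1}^N|w_{ij}|\bigl(\mathrm{sgn}(w_{ij})z_j(t)-z_i(t)\bigr),\qquad z_i(t)=x_i(t)+(1-\sigma)\int_{t-h}^t e^{A(t-h-s)}\Lambda u_i(s)\,ds,\qquad t\ge0,$$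 with $F\in\mathbf R^{n\times n}$. Assume: 1. $\mathcal G$ is structurally balanced, i.e. its vertex set is a disjoint union $\mathcal V^+\cup\mathcal V^-$ (one part may be empty) with $w_{ij}\ge0$ for $i,j$ in the same part and $w_{ij}\le0$ for $i,j$ in different parts; and $\mathcal G$ is quasi-strongly connected, i.e. some vertex has directed paths to all other vertices. 2. All eigenvalues of $A$ lie in the closed left half-plane and those on the imaginary axis are semisimple (equal algebraic and geometric multiplicities). 3. The matrix $F$ is such that $A-\lambda_i\mathcal AF$ is Hurwitz (all eigenvalues have negative real part) for $i=2,\dots,N$, where $\mathcal A=\sigma\Lambda+(1-\sigma)e^{-Ah}\Lambda$ and $\lambda_2,\dots,\lambda_N$ are the eigenvalues of $L$, with algebraic multiplicity, other than one copy of the eigenvalue $0$. Then every solution reaches equal polarization: for every split $\mathcal V^+,\mathcal V^-$ as in condition 1, there is a function $x^*:\mathbf R\to\mathbf R^n$ with $x_i(t)-x^*(t)\to0$ for $i\in\mathcal V^+$ and $x_j(t)+x^*(t)\to0$ for $j\in\mathcal V^-$ as $t\to\infty$. -/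

import Mathlib

open MeasureTheory Filter Topology Matrix

noncomputable section

namespace CoopetitiveOpinion

/-- A weighted signed digraph on the vertices `Fin N`. `w i j ≠ 0` means that there is an edge
from `j` to `i` (individual `j` influences individual `i`), cooperative if `w i j > 0`,
competitive if `w i j < 0`. There are no self-loops and the weights are digon sign-symmetric. -/
structure SignedDigraph (N : ℕ) where
  w : Matrix (Fin N) (Fin N) ℝ
  w_self : ∀ i, w i i = 0
  digon : ∀ i j, 0 ≤ w i j * w j i

variable {N n : ℕ}

/-- The signed Laplacian: `l i i = ∑ j, |w i j|` and `l i j = - w i j` for `i ≠ j`. -/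
def SignedDigraph.laplacian (G : SignedDigraph N) : Matrix (Fin N) (Fin N) ℝ :=
  Matrix.of fun i j => if i = j then ∑ k, |G.w i k| else - G.w i j

/-- The eigenvalues `λ₂, …, λ_N` of the Laplacian, as a multiset of complex numbers: all `N`
eigenvalues with their algebraic multiplicities, one copy of the eigenvalue `0` being left out. -/
def SignedDigraph.restEigenvalues (G : SignedDigraph N) : Multiset ℂ :=
  (G.laplacian.map (algebraMap ℝ ℂ)).charpoly.roots.erase 0

/-- `Vp`, `Vm` is a split of the vertices into two camps: weights inside a camp are nonnegative
and weights between the two camps are nonpositive. One of the camps may be empty. -/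
structure SignedDigraph.IsCampSplit (G : SignedDigraph N) (Vp Vm : Set (Fin N)) : Prop where
  union_eq : Vp ∪ Vm = Set.univ
  inter_eq : Vp ∩ Vm = ∅
  nonneg_plus : ∀ i ∈ Vp, ∀ j ∈ Vp, 0 ≤ G.w i j
  nonneg_minus : ∀ i ∈ Vm, ∀ j ∈ Vm, 0 ≤ G.w i j
  nonpos_plus_minus : ∀ i ∈ Vp, ∀ j ∈ Vm, G.w i j ≤ 0
  nonpos_minus_plus : ∀ i ∈ Vm, ∀ j ∈ Vp, G.w i j ≤ 0

/-- Structural balance. -/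
def SignedDigraph.StructurallyBalanced (G : SignedDigraph N) : Prop :=
  ∃ Vp Vm : Set (Fin N), G.IsCampSplit Vp Vm

/-- Quasi-strong connectivity: some root has a directed path to every vertex. -/
def SignedDigraph.QuasiStronglyConnected (G : SignedDigraph N) : Prop :=
  ∃ r : Fin N, ∀ v : Fin N, Relation.ReflTransGen (fun j i => G.w i j ≠ 0) r v

/-- A complex matrix is Hurwitz if all its eigenvalues have negative real part. -/
def IsHurwitz (M : Matrix (Fin n) (Fin n) ℂ) : Prop :=
  ∀ μ ∈ spectrum ℂ M, μ.re < 0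

/-- `μ` is semisimple for `M`: geometric multiplicity equals algebraic multiplicity. -/
def IsSemisimpleEigenvalue (M : Matrix (Fin n) (Fin n) ℂ) (μ : ℂ) : Prop :=
  Module.finrank ℂ (Module.End.eigenspace (Matrix.toLin' M) μ) = M.charpoly.rootMultiplicity μ

/-- The class `𝒮`: real matrices whose complex spectrum lies in the closed left half-plane
and whose eigenvalues on the imaginary axis are semisimple. -/
def ClassS (A : Matrix (Fin n) (Fin n) ℝ) : Prop :=
  (∀ s ∈ spectrum ℂ (A.map (algebraMap ℝ ℂ)), s.re ≤ 0) ∧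
    ∀ s ∈ spectrum ℂ (A.map (algebraMap ℝ ℂ)), s.re = 0 →
      IsSemisimpleEigenvalue (A.map (algebraMap ℝ ℂ)) s

/-- `Λ = I - A`. -/
def Lam (A : Matrix (Fin n) (Fin n) ℝ) : Matrix (Fin n) (Fin n) ℝ := 1 - A

/-- `𝒜 = σ Λ + (1 - σ) e^{-A h} Λ`. -/
def calA (A : Matrix (Fin n) (Fin n) ℝ) (h σ : ℝ) : Matrix (Fin n) (Fin n) ℝ :=
  σ • Lam A + (1 - σ) • (NormedSpace.exp ((-h) • A) * Lam A)

/-- The predictor state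
`z(t) = x(t) + (1 - σ) ∫_{t-h}^{t} e^{A (t - h - s)} Λ u(s) ds` of one individual. -/
def predictor (A : Matrix (Fin n) (Fin n) ℝ) (h σ : ℝ) (x u : ℝ → Fin n → ℝ) (t : ℝ) :
    Fin n → ℝ :=
  x t + (1 - σ) • ∫ s in (t - h)..t, (NormedSpace.exp ((t - h - s) • A) * Lam A) *ᵥ u s

/-- `x` (opinions, on `[0, ∞)`) and `u` (communication, on `[-h, ∞)`, its restriction to `[-h, 0)`
being an arbitrary integrable history) form a solution of
`x_i' (t) = A x_i (t) + σ Λ u_i (t) + (1 - σ) Λ u_i (t - h)`, `t ≥ 0`, under the rule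
`u_i (t) = F ∑ j, |w i j| (sgn (w i j) z_j (t) - z_i (t))`, `t ≥ 0`. As the delayed input need not
be continuous, the differential equation is understood in the integrated (Carathéodory) sense.
Indices `j` that are not neighbours of `i` have `w i j = 0` and do not contribute to the sum. -/
structure IsSolution (G : SignedDigraph N) (A F : Matrix (Fin n) (Fin n) ℝ) (h σ : ℝ)
    (x u : Fin N → ℝ → Fin n → ℝ) : Prop where
  integrable_u : ∀ i, ∀ T : ℝ, 0 ≤ T → IntervalIntegrable (u i) volume (-h) T
  continuous_x : ∀ i, ContinuousOn (x i) (Set.Ici 0)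
  dynamics : ∀ i, ∀ t : ℝ, 0 ≤ t →
    x i t = x i 0 + ∫ s in (0 : ℝ)..t,
      (A *ᵥ x i s + (σ • Lam A) *ᵥ u i s + ((1 - σ) • Lam A) *ᵥ u i (s - h))
  rule : ∀ i, ∀ t : ℝ, 0 ≤ t →
    u i t = F *ᵥ ∑ j, |G.w i j| •
      (Real.sign (G.w i j) • predictor A h σ (x j) (u j) t - predictor A h σ (x i) (u i) t)

/-- Equal polarization with respect to the camps `Vp`, `Vm`: all opinions in `Vp` approach a
common trajectory `xs`, and all opinions in `Vm` approach `- xs`. -/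
def EqualPolarization (Vp Vm : Set (Fin N)) (x : Fin N → ℝ → Fin n → ℝ) : Prop :=
  ∃ xs : ℝ → Fin n → ℝ,
    (∀ i ∈ Vp, Tendsto (fun t => x i t - xs t) atTop (𝓝 0)) ∧
    (∀ j ∈ Vm, Tendsto (fun t => x j t - (- xs t)) atTop (𝓝 0))

end CoopetitiveOpinion

end

/-! The predictor removes the delay: for `t > h` it satisfies `z_i' = A z_i + 𝒜 u_i`
(`hasDerivAt_predictor`), so the rule closes the loop as `z_i' = A z_i - 𝒜 F ∑ j, L i j z_j`. A camp
split puts its sign vector `d` in the kernel of `L`, so the covectors `φ` with `φ ⬝ᵥ d = 0` form a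
space invariant under `Lᵀ`. Every eigenvalue `μ` of `Lᵀ` on it is among `λ₂, …, λ_N`. An
eigencovector thus gives a combination `q = ∑ φ_i z_i` with Hurwitz dynamics `q' = (A - μ 𝒜 F) q`;
along a chain of generalized eigenvectors the preceding combination enters as a vanishing input.
Hence all these combinations vanish (`tendsto_combination_zero`), in particular `d_i z_i - d_r z_r`.
Then `∑ j, L i j z_j → 0`, so the inputs vanish, and with them the integral that separates `z_i`
from `x_i` (`predictor_sub_tendsto_zero`). -/

noncomputable section

namespace CoopetitiveOpinion

/-! ### Stable linear systems with vanishing input. -/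

/-- Induction along generalized eigenvectors: a property closed under addition that passes from
`f v - μ v` to `v` for every eigenvalue `μ` of `f` holds everywhere. -/
theorem generalizedEigenvector_induction {V : Type*} [AddCommGroup V] [Module ℂ V]
    [FiniteDimensional ℂ V] (f : Module.End ℂ V) (P : V → Prop) (zero : P 0)
    (add : ∀ v w, P v → P w → P (v + w))
    (step : ∀ μ, f.HasEigenvalue μ → ∀ v, P (f v - μ • v) → P v) (v : V) : P v := by
  have key : ∀ μ, f.HasEigenvalue μ → ∀ k : ℕ, ∀ v, ((f - μ • 1) ^ k) v = 0 → P v := by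
    intro μ hμ k
    induction k with
    | zero =>
      intro v hv
      have : v = 0 := by simpa using hv
      exact this ▸ zero
    | succ k ih =>
      intro v hv
      refine step μ hμ v (ih _ ?_)
      rw [pow_succ] at hv
      simpa using hv
  have hv : v ∈ ⨆ μ : ℂ, f.maxGenEigenspace μ := by
    rw [Module.End.iSup_maxGenEigenspace_eq_top]; trivial
  refine Submodule.iSup_induction _ (motive := P) hv (fun μ w hw => ?_) zero add
  by_cases hμ : f.HasEigenvalue μ
  · obtain ⟨k, hk⟩ := (Module.End.mem_maxGenEigenspace f μ w).1 hw
    exact key μ hμ k w hk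
  · have hbot : f.maxGenEigenspace μ = ⊥ := by
      by_contra hne
      have hker : LinearMap.ker (f - μ • (1 : Module.End ℂ V)) = ⊥ := by
        rw [← Module.End.eigenspace_def]
        exact not_not.1 hμ
      have hinj : Function.Injective (f - μ • (1 : Module.End ℂ V)) := LinearMap.ker_eq_bot.1 hker
      refine hne (eq_bot_iff.2 fun y hy => ?_)
      obtain ⟨k, hk⟩ := (Module.End.mem_maxGenEigenspace f μ y).1 hy
      rw [Module.End.pow_apply] at hk
      refine (Submodule.mem_bot ℂ).2 (hinj.iterate k ?_)
      rw [hk, ← Module.End.pow_apply, map_zero]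
    rw [hbot, Submodule.mem_bot] at hw
    exact hw ▸ zero

/-- A stable scalar equation `p' = μ p + g` with vanishing input has vanishing solutions. -/
theorem tendsto_zero_of_hasDerivAt_scalar {μ : ℂ} (hμ : μ.re < 0) {p g : ℝ → ℂ} {T₀ : ℝ}
    (hp : ∀ t, T₀ < t → HasDerivAt p (μ * p t + g t) t) (hg : Tendsto g atTop (𝓝 0)) :
    Tendsto p atTop (𝓝 0) := by
  set a : ℝ := -μ.re with ha
  have ha0 : 0 < a := by simp [ha, hμ]
  rw [Metric.tendsto_nhds]
  intro ε hε
  -- Half of `ε` is spent on the forced response, since `∫ (ε/2) a e^{as} ds` is an increment of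
  -- `(ε/2) e^{as}`, and half on the decaying initial value.
  have hg' : ∀ᶠ t in atTop, ‖g t‖ < ε / 2 * a := by
    have := (Metric.tendsto_nhds.1 hg) (ε / 2 * a) (by positivity)
    simpa using this
  obtain ⟨T, hT⟩ := eventually_atTop.1 (hg'.and (eventually_gt_atTop T₀))
  have hnorm : ∀ t : ℝ, ‖Complex.exp (-μ * t)‖ = Real.exp (a * t) := by
    intro t
    rw [Complex.norm_exp]
    simp [ha]
  have hw : ∀ t, T ≤ t →
      HasDerivAt (fun s : ℝ => Complex.exp (-μ * s) * p s) (Complex.exp (-μ * t) * g t) t := by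
    intro t ht
    have h1 : HasDerivAt (fun s : ℝ => Complex.exp (-μ * s)) (Complex.exp (-μ * t) * (-μ)) t := by
      have := ((Complex.ofRealCLM.hasDerivAt (x := t)).const_mul (-μ)).cexp
      simpa using this
    refine (h1.mul (hp t (hT t ht).2)).congr_deriv ?_
    ring
  have hB : ∀ t : ℝ, HasDerivAt (fun s : ℝ => ‖Complex.exp (-μ * T) * p T‖ +
      ε / 2 * (Real.exp (a * s) - Real.exp (a * T))) (ε / 2 * a * Real.exp (a * t)) t := by
    intro t
    have h1 : HasDerivAt (fun s : ℝ => Real.exp (a * s)) (Real.exp (a * t) * a) t := by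
      have := ((hasDerivAt_id t).const_mul a).exp
      simpa using this
    refine (((h1.sub_const (Real.exp (a * T))).const_mul (ε / 2)).const_add _).congr_deriv ?_
    ring
  have hbound : ∀ t, T ≤ t → ‖Complex.exp (-μ * t) * p t‖ ≤ ‖Complex.exp (-μ * T) * p T‖ +
      ε / 2 * (Real.exp (a * t) - Real.exp (a * T)) := by
    intro t ht
    refine image_norm_le_of_norm_deriv_right_le_deriv_boundary (a := T) (b := t)
      (f := fun s : ℝ => Complex.exp (-μ * s) * p s) (f' := fun s => Complex.exp (-μ * s) * g s)
      (fun s hs => (hw s hs.1).continuousAt.continuousWithinAt)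
      (fun s hs => (hw s hs.1).hasDerivWithinAt) (by simp) hB (fun s hs => ?_) ⟨ht, le_rfl⟩
    rw [norm_mul, hnorm, mul_comm]
    exact mul_le_mul_of_nonneg_right (hT s hs.1).1.le (Real.exp_pos _).le
  have hdecay : ∀ᶠ t : ℝ in atTop, Real.exp (-(a * t)) * ‖Complex.exp (-μ * T) * p T‖ < ε / 2 := by
    have h1 : Tendsto (fun t : ℝ => Real.exp (-(a * t)) * ‖Complex.exp (-μ * T) * p T‖) atTop
        (𝓝 (0 * ‖Complex.exp (-μ * T) * p T‖)) :=
      (Real.tendsto_exp_neg_atTop_nhds_zero.comp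
        (tendsto_id.const_mul_atTop ha0)).mul_const _
    rw [zero_mul] at h1
    exact h1.eventually_lt_const (by positivity)
  filter_upwards [hdecay, eventually_ge_atTop T] with t ht htT
  have h1 := hbound t htT
  rw [norm_mul, hnorm] at h1
  have h2 : ‖p t‖ = Real.exp (-(a * t)) * (Real.exp (a * t) * ‖p t‖) := by
    rw [← mul_assoc, ← Real.exp_add]; simp
  have h3 : Real.exp (-(a * t)) * Real.exp (a * t) = 1 := by rw [← Real.exp_add]; simp
  rw [dist_zero_right, h2]
  calc _ ≤ Real.exp (-(a * t)) * (‖Complex.exp (-μ * T) * p T‖ +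
      ε / 2 * (Real.exp (a * t) - Real.exp (a * T))) := by gcongr
    _ = Real.exp (-(a * t)) * ‖Complex.exp (-μ * T) * p T‖ + ε / 2
        - ε / 2 * (Real.exp (-(a * t)) * Real.exp (a * T)) := by
      linear_combination (ε / 2) * h3
    _ < ε := by
      have : 0 < ε / 2 * (Real.exp (-(a * t)) * Real.exp (a * T)) := by positivity
      linarith

/-- A Hurwitz linear system with vanishing input has vanishing solutions. -/
theorem IsHurwitz.tendsto_zero {n : ℕ} {M : Matrix (Fin n) (Fin n) ℂ} (hM : IsHurwitz M)
    {q g : ℝ → Fin n → ℂ} {T₀ : ℝ} (hq : ∀ t, T₀ < t → HasDerivAt q (M *ᵥ q t + g t) t)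
    (hg : Tendsto g atTop (𝓝 0)) : Tendsto q atTop (𝓝 0) := by
  have hdot : ∀ (v : Fin n → ℂ) {c : ℝ → Fin n → ℂ}, Tendsto c atTop (𝓝 0) →
      Tendsto (fun t => v ⬝ᵥ c t) atTop (𝓝 0) := by
    intro v c hc
    have : Continuous fun y : Fin n → ℂ => v ⬝ᵥ y := continuous_const.dotProduct continuous_id
    simpa [Function.comp_def] using (this.tendsto 0).comp hc
  -- Pairing with `v` gives `(v ⬝ᵥ q)' = μ (v ⬝ᵥ q) + (Mᵀ v - μ v) ⬝ᵥ q + v ⬝ᵥ g`; the middle term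
  -- vanishes asymptotically by the induction.
  have key : ∀ v : Fin n → ℂ, Tendsto (fun t => v ⬝ᵥ q t) atTop (𝓝 0) := by
    refine generalizedEigenvector_induction (Matrix.toLin' Mᵀ)
      (fun v => Tendsto (fun t => v ⬝ᵥ q t) atTop (𝓝 0)) (by simp) ?_ ?_
    · intro v w hv hw
      simpa [add_dotProduct] using hv.add hw
    · intro μ hμ v hv
      have hμM : μ ∈ spectrum ℂ M := by
        have h1 := hμ.mem_spectrum
        rw [Matrix.spectrum_toLin'] at h1
        rw [Matrix.mem_spectrum_iff_isRoot_charpoly] at h1 ⊢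
        rwa [Matrix.charpoly_transpose] at h1
      refine tendsto_zero_of_hasDerivAt_scalar (hM μ hμM) (T₀ := T₀)
        (g := fun t => (Matrix.toLin' Mᵀ v - μ • v) ⬝ᵥ q t + v ⬝ᵥ g t) (fun t ht => ?_) ?_
      · have h1 : HasDerivAt (fun s => ∑ i, v i * q s i) (∑ i, v i * (M *ᵥ q t + g t) i) t :=
          HasDerivAt.fun_sum fun i _ => ((hasDerivAt_pi.1 (hq t ht)) i).const_mul (v i)
        refine HasDerivAt.congr_deriv h1 ?_
        change v ⬝ᵥ (M *ᵥ q t + g t) = _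
        rw [Matrix.toLin'_apply, Matrix.mulVec_transpose, sub_dotProduct, dotProduct_add,
          smul_dotProduct, Matrix.dotProduct_mulVec, smul_eq_mul]
        ring
      · simpa using hv.add (hdot v hg)
  rw [tendsto_pi_nhds]
  intro i
  simpa using key (Pi.single i 1)

/-! ### Spectrum of the Laplacian on the annihilator of `d`, and networks. -/

/-- If `0` is an eigenvalue of `L` with eigenvector `d`, and a nonzero left null vector of `L` is
orthogonal to `d`, then `0` is a multiple root of the characteristic polynomial. -/
theorem two_le_count_roots_charpoly_zero {N : ℕ} {L : Matrix (Fin N) (Fin N) ℂ} {d φ : Fin N → ℂ}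
    (hd0 : d ≠ 0) (hd : L *ᵥ d = 0) (hφ0 : φ ≠ 0) (hφ : φ ᵥ* L = 0) (hφd : φ ⬝ᵥ d = 0) :
    2 ≤ L.charpoly.roots.count 0 := by
  classical
  have hfin := LinearMap.finrank_maxGenEigenspace_eq (Matrix.toLin' L) 0
  rw [Matrix.charpoly_toLin'] at hfin
  rw [Polynomial.count_roots, ← hfin]
  obtain ⟨k, hk⟩ := eventually_atTop.1 (Matrix.toLin' L).eventually_isCompl_ker_pow_range_pow
  -- Fitting decomposition. The exponent `k + 1` is positive, so the range of the power lies in the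
  -- range of `L`, which `φ` annihilates.
  have hcompl := hk (k + 1) (Nat.le_succ k)
  have hrange : ∀ y, φ ⬝ᵥ ((Matrix.toLin' L ^ (k + 1)) y) = 0 := by
    intro y
    rw [pow_succ', Module.End.mul_apply, Matrix.toLin'_apply, Matrix.dotProduct_mulVec, hφ,
      zero_dotProduct]
  obtain ⟨v, hvker, hv⟩ : ∃ v, (Matrix.toLin' L ^ (k + 1)) v = 0 ∧ φ ⬝ᵥ v ≠ 0 := by
    by_contra! hcon
    apply hφ0
    refine dotProduct_eq_zero _ fun w => ?_
    have hw : w ∈ LinearMap.ker (Matrix.toLin' L ^ (k + 1)) ⊔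
        LinearMap.range (Matrix.toLin' L ^ (k + 1)) := by
      rw [hcompl.sup_eq_top]; trivial
    obtain ⟨y, hy, z, ⟨z', rfl⟩, rfl⟩ := Submodule.mem_sup.1 hw
    rw [dotProduct_add, hcon y hy, hrange, add_zero]
  set S := Module.End.maxGenEigenspace (Matrix.toLin' L) 0
  have hdS : d ∈ S := (Module.End.mem_maxGenEigenspace _ _ _).2 ⟨1, by simpa using hd⟩
  have hvS : v ∈ S := (Module.End.mem_maxGenEigenspace _ _ _).2 ⟨k + 1, by simpa using hvker⟩
  -- `φ` vanishes on `d` but not on `v`, so the generalized null space has dimension at least two.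
  have hli : LinearIndependent ℂ ![(⟨d, hdS⟩ : S), ⟨v, hvS⟩] := by
    rw [LinearIndependent.pair_iff]
    intro s t hst
    have hst' : s • d + t • v = 0 := congrArg Subtype.val hst
    have h1 := congrArg (fun y => φ ⬝ᵥ y) hst'
    simp only [dotProduct_add, dotProduct_smul, hφd, dotProduct_zero, smul_eq_mul, mul_zero,
      zero_add, mul_eq_zero, hv, or_false] at h1
    refine ⟨?_, h1⟩
    rw [h1, zero_smul, add_zero] at hst'
    exact (smul_eq_zero.1 hst').resolve_right hd0
  simpa using hli.fintype_card_le_finrank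

/-- Networks of identical linear systems `z_i' = A z_i - B ∑ j, L i j z_j` with `L d = 0`: if
`A - l B` is Hurwitz for all eigenvalues `l` of `L` except one copy of `0`, then every linear
combination of the states with coefficients orthogonal to `d` vanishes asymptotically. -/
theorem tendsto_combination_zero {N n : ℕ} {L : Matrix (Fin N) (Fin N) ℂ} {d : Fin N → ℂ}
    (hd0 : d ≠ 0) (hd : L *ᵥ d = 0) {A B : Matrix (Fin n) (Fin n) ℂ}
    (hF : ∀ l ∈ L.charpoly.roots.erase 0, IsHurwitz (A - l • B)) {z : Fin N → ℝ → Fin n → ℂ}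
    {T₀ : ℝ} (hz : ∀ i t, T₀ < t → HasDerivAt (z i) (A *ᵥ z i t - B *ᵥ ∑ j, L i j • z j t) t)
    {φ : Fin N → ℂ} (hφ : φ ⬝ᵥ d = 0) : Tendsto (fun t => ∑ i, φ i • z i t) atTop (𝓝 0) := by
  classical
  let E : Submodule ℂ (Fin N → ℂ) :=
    { carrier := {φ | φ ⬝ᵥ d = 0}
      zero_mem' := zero_dotProduct d
      add_mem' := fun {a b} ha hb => by
        rw [Set.mem_ofPred_eq] at ha hb ⊢
        rw [add_dotProduct, ha, hb, add_zero]
      smul_mem' := fun c a ha => by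
        rw [Set.mem_ofPred_eq] at ha ⊢
        rw [smul_dotProduct, ha, smul_zero] }
  have hE : ∀ φ ∈ E, Matrix.toLin' Lᵀ φ ∈ E := by
    intro φ _
    change (Matrix.toLin' Lᵀ φ) ⬝ᵥ d = 0
    rw [Matrix.toLin'_apply, Matrix.mulVec_transpose, ← Matrix.dotProduct_mulVec, hd,
      dotProduct_zero]
  refine generalizedEigenvector_induction ((Matrix.toLin' Lᵀ).restrict hE)
    (fun φ => Tendsto (fun t => ∑ i, φ.1 i • z i t) atTop (𝓝 0)) (by simp) ?_ ?_ ⟨φ, hφ⟩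
  · intro v w hv hw
    simpa [add_smul, Finset.sum_add_distrib] using hv.add hw
  · intro μ hμ v hv
    have hmem : μ ∈ L.charpoly.roots.erase 0 := by
      obtain ⟨ψ, hψ⟩ := hμ.exists_hasEigenvector
      have hψ1 : ψ.1 ᵥ* L = μ • ψ.1 := by
        have := congrArg Subtype.val hψ.apply_eq_smul
        simpa [Matrix.mulVec_transpose] using this
      have hψ0 : ψ.1 ≠ 0 := fun h => hψ.2 (Subtype.ext h)
      -- For `μ = 0` the root is multiple, so a copy survives the erasure; a nonzero `μ` is
      -- untouched by it.
      by_cases h0 : μ = 0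
      · subst h0
        rw [zero_smul] at hψ1
        have := two_le_count_roots_charpoly_zero hd0 hd hψ0 hψ1 ψ.2
        rw [← Multiset.count_pos, Multiset.count_erase_self]
        omega
      · rw [Multiset.mem_erase_of_ne h0, Polynomial.mem_roots L.charpoly_monic.ne_zero,
          ← Matrix.charpoly_transpose, ← Matrix.mem_spectrum_iff_isRoot_charpoly,
          ← Matrix.spectrum_toLin']
        refine (Module.End.hasEigenvalue_of_hasEigenvector (x := ψ.1)
          (Module.End.hasEigenvector_iff.2 ⟨?_, hψ0⟩)).mem_spectrum
        rw [Module.End.mem_eigenspace_iff, Matrix.toLin'_apply, Matrix.mulVec_transpose, hψ1]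
    refine (hF μ hmem).tendsto_zero (T₀ := T₀) (g := fun t => -(B *ᵥ
      ∑ i, ((Matrix.toLin' Lᵀ).restrict hE v - μ • v).1 i • z i t)) (fun t ht => ?_) ?_
    · have h1 : HasDerivAt (fun t => ∑ i, v.1 i • z i t)
          (∑ i, v.1 i • (A *ᵥ z i t - B *ᵥ ∑ j, L i j • z j t)) t :=
        HasDerivAt.fun_sum fun i _ => (hz i t ht).const_smul (v.1 i)
      refine h1.congr_deriv (Eq.symm ?_)
      have h2 : ∑ i, ((Matrix.toLin' Lᵀ).restrict hE v - μ • v).1 i • z i t =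
          ∑ i, v.1 i • ∑ j, L i j • z j t - μ • ∑ i, v.1 i • z i t := by
        have h3 : ∀ i, ((Matrix.toLin' Lᵀ).restrict hE v - μ • v).1 i =
            ∑ j, v.1 j * L j i - μ * v.1 i := by
          intro i
          simp [Matrix.mulVec_transpose, Matrix.vecMul, dotProduct]
        simp only [h3, sub_smul, Finset.sum_smul, Finset.sum_sub_distrib, Finset.smul_sum, mul_smul]
        rw [Finset.sum_comm]
      rw [h2]
      simp only [smul_sub, Finset.sum_sub_distrib, ← Matrix.mulVec_smul, ← Matrix.mulVec_sum,
        Matrix.mulVec_sub, Matrix.sub_mulVec, Matrix.smul_mulVec]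
      abel
    · have hc : Continuous fun y : Fin n → ℂ => -(B *ᵥ y) :=
        (continuous_const.matrix_mulVec continuous_id).neg
      simpa [Function.comp_def] using (hc.tendsto 0).comp hv

/-! ### The predictor and the delay-free system. -/

theorem intervalIntegrable_mulVec {n : ℕ} {M : ℝ → Matrix (Fin n) (Fin n) ℝ} (hM : Continuous M)
    {u : ℝ → Fin n → ℝ} {a b : ℝ} (hu : IntervalIntegrable u volume a b) :
    IntervalIntegrable (fun s => M s *ᵥ u s) volume a b := by
  have hcomp : ∀ j, IntervalIntegrable (fun s => u s j) volume a b := fun j =>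
    ⟨hu.1.eval j, hu.2.eval j⟩
  have hsum : IntervalIntegrable (fun s => ∑ j, u s j • fun i => M s i j) volume a b := by
    have := IntervalIntegrable.sum Finset.univ (f := fun j s => u s j • fun i => M s i j)
      (μ := volume) (a := a) (b := b) fun j _ => (hcomp j).smul_continuousOn
        (continuous_pi fun i => hM.matrix_elem i j).continuousOn
    simpa [Finset.sum_fn] using this
  convert hsum using 2 with s
  ext i
  simp [Matrix.mulVec, dotProduct, mul_comm]

/-- Differentiating `M` entrywise keeps the statement independent of a norm on matrices. -/
theorem hasDerivAt_mulVec {n : ℕ} {M : ℝ → Matrix (Fin n) (Fin n) ℝ}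
    {M' : Matrix (Fin n) (Fin n) ℝ} {v : ℝ → Fin n → ℝ} {v' : Fin n → ℝ} {t : ℝ}
    (hM : ∀ i j, HasDerivAt (fun s => M s i j) (M' i j) t) (hv : HasDerivAt v v' t) :
    HasDerivAt (fun s => M s *ᵥ v s) (M' *ᵥ v t + M t *ᵥ v') t := by
  rw [hasDerivAt_pi] at hv ⊢
  intro i
  have := HasDerivAt.fun_sum (u := Finset.univ) fun j _ => (hM i j).mul (hv j)
  refine HasDerivAt.congr_deriv this ?_
  simp [Matrix.mulVec, dotProduct, Finset.sum_add_distrib]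

section MatrixExp

attribute [local instance] Matrix.linftyOpNormedRing Matrix.linftyOpNormedAlgebra
  Matrix.linftyOpNormedAddCommGroup Matrix.linftyOpNormedSpace

theorem hasDerivAt_matrix_exp {n : ℕ} (A : Matrix (Fin n) (Fin n) ℝ) (t : ℝ) (i j : Fin n) :
    HasDerivAt (fun s : ℝ => NormedSpace.exp (s • A) i j) ((A * NormedSpace.exp (t • A)) i j) t := by
  have h1 := hasDerivAt_exp_smul_const' (𝕂 := ℝ) A t
  exact (Matrix.entryLinearMap ℝ ℝ i j).toContinuousLinearMap.hasFDerivAt.comp_hasDerivAt t h1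

theorem continuous_matrix_exp {n : ℕ} (A : Matrix (Fin n) (Fin n) ℝ) :
    Continuous fun s : ℝ => NormedSpace.exp (s • A) :=
  continuous_pi fun i => continuous_pi fun j =>
    continuous_iff_continuousAt.2 fun t => (hasDerivAt_matrix_exp A t i j).continuousAt

theorem matrix_exp_add_smul {n : ℕ} (A : Matrix (Fin n) (Fin n) ℝ) (s t : ℝ) :
    NormedSpace.exp ((s + t) • A) = NormedSpace.exp (s • A) * NormedSpace.exp (t • A) := by
  rw [add_smul, Matrix.exp_add_of_commute]
  exact ((Commute.refl A).smul_left s).smul_right t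

/-- The distributed part of the predictor vanishes asymptotically when the input does. -/
theorem predictor_sub_tendsto_zero {n : ℕ} (A : Matrix (Fin n) (Fin n) ℝ) {h : ℝ} (hh : 0 < h)
    (σ : ℝ) (x : ℝ → Fin n → ℝ) {u : ℝ → Fin n → ℝ} (hu : Tendsto u atTop (𝓝 0)) :
    Tendsto (fun t => predictor A h σ x u t - x t) atTop (𝓝 0) := by
  have hcont : Continuous fun r : ℝ => NormedSpace.exp (r • A) * Lam A :=
    (continuous_matrix_exp A).matrix_mul continuous_const
  -- For `s` in the window `(t - h, t]` the exponent `t - h - s` stays in `[-h, 0]`, so one constant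
  -- bounds the kernel for all `t`.
  obtain ⟨C, hC⟩ := (isCompact_Icc (a := -h) (b := 0)).exists_bound_of_continuousOn
    hcont.continuousOn
  have hC0 : 0 ≤ C := (norm_nonneg _).trans (hC 0 ⟨by linarith, le_rfl⟩)
  have hint : Tendsto (fun t => ∫ s in (t - h)..t,
      (NormedSpace.exp ((t - h - s) • A) * Lam A) *ᵥ u s) atTop (𝓝 0) := by
    rw [Metric.tendsto_nhds]
    intro ε hε
    have hδ : 0 < ε / (C * h + 1) := by positivity
    obtain ⟨T, hT⟩ := eventually_atTop.1 ((Metric.tendsto_nhds.1 hu) _ hδ)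
    filter_upwards [eventually_ge_atTop (T + h)] with t ht
    rw [dist_zero_right]
    have hb := intervalIntegral.norm_integral_le_of_norm_le_const (a := t - h) (b := t)
      (f := fun s => (NormedSpace.exp ((t - h - s) • A) * Lam A) *ᵥ u s)
      (C := C * (ε / (C * h + 1))) (fun s hs => ?_)
    · refine hb.trans_lt ?_
      rw [sub_sub_cancel, abs_of_pos hh, show C * (ε / (C * h + 1)) * h =
        ε * ((C * h) / (C * h + 1)) by ring]
      have : (C * h) / (C * h + 1) < 1 := by rw [div_lt_one (by positivity)]; linarith
      nlinarith
    · rw [Set.uIoc_of_le (by linarith)] at hs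
      refine (Matrix.linfty_opNorm_mulVec _ _).trans ?_
      have h1 : ‖u s‖ < ε / (C * h + 1) := by simpa using hT s (by linarith [hs.1])
      have h2 := hC (t - h - s) ⟨by linarith [hs.2], by linarith [hs.1]⟩
      exact mul_le_mul h2 h1.le (norm_nonneg _) hC0
  simpa [predictor] using hint.const_smul (1 - σ)

end MatrixExp

/-- The predictor with the exponential of the current time taken out of the integral. -/
theorem predictor_eq {n : ℕ} (A : Matrix (Fin n) (Fin n) ℝ) {h : ℝ} (hh : 0 < h) (σ : ℝ)
    (x : ℝ → Fin n → ℝ) {u : ℝ → Fin n → ℝ}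
    (hu : ∀ T : ℝ, 0 ≤ T → IntervalIntegrable u volume (-h) T) {t : ℝ} (ht : 0 ≤ t) :
    predictor A h σ x u t = x t + (1 - σ) • NormedSpace.exp ((t - h) • A) *ᵥ
      ((∫ s in (-h)..t, (NormedSpace.exp ((-s) • A) * Lam A) *ᵥ u s) -
        ∫ s in (-h)..(t - h), (NormedSpace.exp ((-s) • A) * Lam A) *ᵥ u s) := by
  have hg : IntervalIntegrable (fun s => (NormedSpace.exp ((-s) • A) * Lam A) *ᵥ u s)
      volume (-h) t :=
    intervalIntegrable_mulVec (((continuous_matrix_exp A).comp continuous_neg).matrix_mul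
      continuous_const) (hu t ht)
  have hsub : Set.uIcc (-h) (t - h) ⊆ Set.uIcc (-h) t := by
    rw [Set.uIcc_of_le (by linarith), Set.uIcc_of_le (by linarith)]
    exact Set.Icc_subset_Icc le_rfl (by linarith)
  have hsub' : Set.uIcc (t - h) t ⊆ Set.uIcc (-h) t := by
    rw [Set.uIcc_of_le (by linarith), Set.uIcc_of_le (by linarith)]
    exact Set.Icc_subset_Icc (by linarith) le_rfl
  rw [predictor, intervalIntegral.integral_interval_sub_left hg (hg.mono_set hsub)]
  congr 2
  have := (Matrix.toLin' (NormedSpace.exp ((t - h) • A))).toContinuousLinearMap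
    |>.intervalIntegral_comp_comm (hg.mono_set hsub')
  simp only [LinearMap.coe_toContinuousLinearMap', Matrix.toLin'_apply] at this
  rw [← this]
  congr 1
  ext1 s
  rw [Matrix.mulVec_mulVec, ← mul_assoc, ← matrix_exp_add_smul, sub_eq_add_neg (t - h) s]

/-- This starts the regularity bootstrap: the history is merely integrable, but continuous
predictors make `u` continuous on `(0, ∞)` through the rule, hence `u (t - h)` continuous for `t >
h`. -/
theorem continuousOn_predictor {n : ℕ} (A : Matrix (Fin n) (Fin n) ℝ) {h : ℝ} (hh : 0 < h) (σ : ℝ)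
    {x u : ℝ → Fin n → ℝ} (hx : ContinuousOn x (Set.Ici 0))
    (hu : ∀ T : ℝ, 0 ≤ T → IntervalIntegrable u volume (-h) T) :
    ContinuousOn (predictor A h σ x u) (Set.Ioi 0) := by
  set U : ℝ → Fin n → ℝ := fun t =>
    ∫ s in (-h)..t, (NormedSpace.exp ((-s) • A) * Lam A) *ᵥ u s with hU
  have hUc : ∀ t, -h < t → ContinuousAt U t := by
    intro t ht
    have hg : IntervalIntegrable (fun s => (NormedSpace.exp ((-s) • A) * Lam A) *ᵥ u s)
        volume (-h) (|t| + 1) :=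
      intervalIntegrable_mulVec (((continuous_matrix_exp A).comp continuous_neg).matrix_mul
        continuous_const) (hu _ (by positivity))
    have := intervalIntegral.continuousOn_primitive_interval' hg Set.left_mem_uIcc
    refine this.continuousAt ?_
    have h1 := le_abs_self t
    rw [Set.uIcc_of_le (by linarith)]
    exact Icc_mem_nhds ht (by linarith)
  have heq : Set.EqOn (predictor A h σ x u) (fun t => x t + (1 - σ) •
      NormedSpace.exp ((t - h) • A) *ᵥ (U t - U (t - h))) (Set.Ioi 0) :=
    fun t ht => predictor_eq A hh σ x hu (le_of_lt ht)
  refine ContinuousOn.congr (fun t ht => ?_) heq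
  rw [Set.mem_Ioi] at ht
  have h1 : ContinuousAt x t := hx.continuousAt (Ici_mem_nhds ht)
  have h2 : ContinuousAt (fun t => U (t - h)) t :=
    ContinuousAt.comp (f := fun t : ℝ => t - h) (hUc (t - h) (by linarith))
      (continuous_id.sub continuous_const).continuousAt
  have h3 : ContinuousAt (fun t => NormedSpace.exp ((t - h) • A)) t :=
    ((continuous_matrix_exp A).comp (continuous_id.sub continuous_const)).continuousAt
  have h4 : ContinuousAt (fun t => NormedSpace.exp ((t - h) • A) *ᵥ (U t - U (t - h))) t := by
    have hc : Continuous fun p : Matrix (Fin n) (Fin n) ℝ × (Fin n → ℝ) => p.1 *ᵥ p.2 :=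
      continuous_fst.matrix_mulVec continuous_snd
    exact hc.continuousAt.comp (f := fun t => (NormedSpace.exp ((t - h) • A), U t - U (t - h)))
      (h3.prodMk ((hUc t (by linarith)).sub h2))
  exact (h1.add (h4.const_smul (1 - σ))).continuousWithinAt

/-- Once the delayed input is continuous, the predictor follows the delay-free system
`z' = A z + 𝒜 u`. -/
theorem hasDerivAt_predictor {n : ℕ} (A : Matrix (Fin n) (Fin n) ℝ) {h : ℝ} (hh : 0 < h) (σ : ℝ)
    {x u : ℝ → Fin n → ℝ} (hx : ContinuousOn x (Set.Ici 0))
    (hu : ∀ T : ℝ, 0 ≤ T → IntervalIntegrable u volume (-h) T)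
    (huc : ContinuousOn u (Set.Ioi 0))
    (hdyn : ∀ t : ℝ, 0 ≤ t → x t = x 0 + ∫ s in (0 : ℝ)..t,
      (A *ᵥ x s + (σ • Lam A) *ᵥ u s + ((1 - σ) • Lam A) *ᵥ u (s - h)))
    {t : ℝ} (ht : h < t) :
    HasDerivAt (predictor A h σ x u) (A *ᵥ predictor A h σ x u t + calA A h σ *ᵥ u t) t := by
  have hconst : ∀ M : Matrix (Fin n) (Fin n) ℝ, Continuous fun v : Fin n → ℝ => M *ᵥ v :=
    fun M => continuous_const.matrix_mulVec continuous_id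
  have hx' : HasDerivAt x
      (A *ᵥ x t + (σ • Lam A) *ᵥ u t + ((1 - σ) • Lam A) *ᵥ u (t - h)) t := by
    set f : ℝ → Fin n → ℝ := fun s =>
      A *ᵥ x s + (σ • Lam A) *ᵥ u s + ((1 - σ) • Lam A) *ᵥ u (s - h)
    have hfc : ContinuousOn f (Set.Ioi h) := by
      have h1 : ContinuousOn x (Set.Ioi h) :=
        hx.mono fun s hs => hh.le.trans (le_of_lt hs)
      have h2 : ContinuousOn u (Set.Ioi h) := huc.mono fun s hs => hh.trans hs
      have h3 : ContinuousOn (fun s => u (s - h)) (Set.Ioi h) :=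
        huc.comp (continuous_id.sub continuous_const).continuousOn fun s hs =>
          Set.mem_Ioi.2 (sub_pos.2 hs)
      exact (((hconst _).comp_continuousOn h1).add ((hconst _).comp_continuousOn h2)).add
        ((hconst _).comp_continuousOn h3)
    have hfi : IntervalIntegrable f volume 0 t := by
      have h1 : IntervalIntegrable x volume 0 t :=
        (hx.mono (by rw [Set.uIcc_of_le (by linarith)]; exact Set.Icc_subset_Ici_self)).intervalIntegrable
      have h2 : IntervalIntegrable u volume 0 t := (hu t (by linarith)).mono_set <| by
        rw [Set.uIcc_of_le (by linarith), Set.uIcc_of_le (by linarith)]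
        exact Set.Icc_subset_Icc (by linarith) le_rfl
      have h3 : IntervalIntegrable (fun s => u (s - h)) volume 0 t := by
        have := (hu (t - h) (by linarith)).comp_sub_right h
        simpa using this
      exact ((intervalIntegrable_mulVec continuous_const h1).add
        (intervalIntegrable_mulVec continuous_const h2)).add
        (intervalIntegrable_mulVec continuous_const h3)
    have hF := intervalIntegral.integral_hasDerivAt_right hfi
      (hfc.stronglyMeasurableAtFilter isOpen_Ioi t ht) (hfc.continuousAt (Ioi_mem_nhds ht))
    refine (hF.const_add (x 0)).congr_of_eventuallyEq ?_
    filter_upwards [Ioi_mem_nhds ht] with s hs using hdyn s (hh.le.trans (le_of_lt hs))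
  set g : ℝ → Fin n → ℝ := fun s => (NormedSpace.exp ((-s) • A) * Lam A) *ᵥ u s with hgdef
  have hMc : Continuous fun s : ℝ => NormedSpace.exp ((-s) • A) * Lam A :=
    ((continuous_matrix_exp A).comp continuous_neg).matrix_mul continuous_const
  have hgc : ContinuousOn g (Set.Ioi 0) := by
    have hc : Continuous fun p : Matrix (Fin n) (Fin n) ℝ × (Fin n → ℝ) => p.1 *ᵥ p.2 :=
      continuous_fst.matrix_mulVec continuous_snd
    exact hc.comp_continuousOn (hMc.continuousOn.prodMk huc)
  have hU : ∀ r, 0 < r → HasDerivAt (fun r => ∫ s in (-h)..r, g s) (g r) r := fun r hr =>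
    intervalIntegral.integral_hasDerivAt_right (intervalIntegrable_mulVec hMc (hu r hr.le))
      (hgc.stronglyMeasurableAtFilter isOpen_Ioi r hr) (hgc.continuousAt (Ioi_mem_nhds hr))
  have hV := (hU t (hh.trans ht)).sub ((hU (t - h) (sub_pos.2 ht)).comp_sub_const t h)
  have hE : ∀ i j, HasDerivAt (fun s : ℝ => NormedSpace.exp ((s - h) • A) i j)
      ((A * NormedSpace.exp ((t - h) • A)) i j) t := fun i j =>
    (hasDerivAt_matrix_exp A (t - h) i j).comp_sub_const t h
  have hz := hx'.add ((hasDerivAt_mulVec hE hV).const_smul (1 - σ))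
  refine (hz.congr_of_eventuallyEq ?_).congr_deriv ?_
  · filter_upwards [Ioi_mem_nhds (hh.trans ht)] with s hs using
      predictor_eq A hh σ x hu (le_of_lt hs)
  · have hpred : predictor A h σ x u t = x t + (1 - σ) • NormedSpace.exp ((t - h) • A) *ᵥ
        ((∫ s in (-h)..t, g s) - ∫ s in (-h)..(t - h), g s) :=
      predictor_eq A hh σ x hu (hh.trans ht).le
    rw [hpred]
    -- The moving endpoints of the window: the upper one yields the `e^{-Ah} Λ` part of `𝒜`, the
    -- lower one cancels the delayed input in `x'`.
    have e1 : NormedSpace.exp ((t - h) • A) *ᵥ g t =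
        (NormedSpace.exp ((-h) • A) * Lam A) *ᵥ u t := by
      rw [hgdef, Matrix.mulVec_mulVec, ← mul_assoc, ← matrix_exp_add_smul]
      congr 4; ring
    have e2 : NormedSpace.exp ((t - h) • A) *ᵥ g (t - h) = Lam A *ᵥ u (t - h) := by
      rw [hgdef, Matrix.mulVec_mulVec, ← mul_assoc, ← matrix_exp_add_smul]
      simp
    simp only [calA, Pi.sub_apply, Matrix.mulVec_sub, e1, e2, Matrix.add_mulVec, Matrix.smul_mulVec,
      Matrix.mulVec_add, Matrix.mulVec_smul, ← Matrix.mulVec_mulVec, smul_add, smul_sub]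
    module

/-! ### The Laplacian of a structurally balanced digraph. -/

/-- The signs of a camp split. -/
def campSign {N : ℕ} (Vp : Set (Fin N)) (i : Fin N) : ℝ :=
  open Classical in if i ∈ Vp then 1 else -1

theorem campSign_mul_self {N : ℕ} (Vp : Set (Fin N)) (i : Fin N) :
    campSign Vp i * campSign Vp i = 1 := by
  unfold campSign; split_ifs <;> norm_num

/-- A nonzero weight has the sign `d_i d_j`, and `d_j` squares to one: changing signs by `d` turns
the graph into one with nonnegative weights. -/
theorem SignedDigraph.IsCampSplit.w_mul_campSign {N : ℕ} {G : SignedDigraph N}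
    {Vp Vm : Set (Fin N)} (hs : G.IsCampSplit Vp Vm) (i j : Fin N) :
    G.w i j * campSign Vp j = |G.w i j| * campSign Vp i := by
  have hm : ∀ k, k ∉ Vp → k ∈ Vm := fun k hk =>
    ((hs.union_eq ▸ Set.mem_univ k : k ∈ Vp ∪ Vm)).resolve_left hk
  unfold campSign
  split_ifs with hj hi hi
  · rw [abs_of_nonneg (hs.nonneg_plus i hi j hj)]
  · rw [abs_of_nonpos (hs.nonpos_minus_plus i (hm i hi) j hj)]; ring
  · rw [abs_of_nonpos (hs.nonpos_plus_minus i hi j (hm j hj))]; ring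
  · rw [abs_of_nonneg (hs.nonneg_minus i (hm i hi) j (hm j hj))]

theorem SignedDigraph.sum_laplacian_smul {N : ℕ} (G : SignedDigraph N) {V : Type*}
    [AddCommGroup V] [Module ℝ V] (i : Fin N) (v : Fin N → V) :
    ∑ j, G.laplacian i j • v j = (∑ k, |G.w i k|) • v i - ∑ j, G.w i j • v j := by
  have h1 : ∀ j, G.laplacian i j • v j =
      (if i = j then (∑ k, |G.w i k|) • v j else 0) - G.w i j • v j := by
    intro j
    by_cases hij : i = j
    · subst hij; simp [SignedDigraph.laplacian, G.w_self]
    · simp [SignedDigraph.laplacian, hij]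
  simp [h1, Finset.sum_sub_distrib]

/-- The communication term is the negative Laplacian. -/
theorem SignedDigraph.sum_abs_smul_sign_sub {N : ℕ} (G : SignedDigraph N) {V : Type*}
    [AddCommGroup V] [Module ℝ V] (i : Fin N) (v : Fin N → V) :
    ∑ j, |G.w i j| • (Real.sign (G.w i j) • v j - v i) = -∑ j, G.laplacian i j • v j := by
  rw [G.sum_laplacian_smul, neg_sub, Finset.sum_smul, ← Finset.sum_sub_distrib]
  refine Finset.sum_congr rfl fun j _ => ?_
  have h1 : |G.w i j| * Real.sign (G.w i j) = G.w i j := by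
    rcases lt_trichotomy (G.w i j) 0 with hw | hw | hw
    · rw [abs_of_neg hw, Real.sign_of_neg hw]; ring
    · simp [hw]
    · rw [abs_of_pos hw, Real.sign_of_pos hw]; ring
  rw [smul_sub, smul_smul, h1]

theorem SignedDigraph.IsCampSplit.laplacian_mulVec_campSign {N : ℕ} {G : SignedDigraph N}
    {Vp Vm : Set (Fin N)} (hs : G.IsCampSplit Vp Vm) : G.laplacian *ᵥ campSign Vp = 0 := by
  ext i
  have h1 := G.sum_laplacian_smul i (campSign Vp)
  simp only [smul_eq_mul, hs.w_mul_campSign, ← Finset.sum_mul, sub_self] at h1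
  exact h1

theorem ofReal_mulVec {n : ℕ} (M : Matrix (Fin n) (Fin n) ℝ) (v : Fin n → ℝ) :
    (fun k => ((M *ᵥ v) k : ℂ)) = M.map (algebraMap ℝ ℂ) *ᵥ fun k => (v k : ℂ) := by
  ext k
  simp [Matrix.mulVec, dotProduct]

/-! ### Consensus of the signed predictors and polarization. -/

/-- Under the memory communication rule the predictors, weighted with the signs of a camp split,
reach consensus. -/
theorem IsSolution.predictor_consensus {N n : ℕ} {G : SignedDigraph N}
    {A F : Matrix (Fin n) (Fin n) ℝ} {h σ : ℝ} (hh : 0 < h)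
    (hF : ∀ l ∈ G.restEigenvalues, IsHurwitz (A.map (algebraMap ℝ ℂ) -
      l • (calA A h σ * F).map (algebraMap ℝ ℂ)))
    {x u : Fin N → ℝ → Fin n → ℝ} (hsol : IsSolution G A F h σ x u) {Vp Vm : Set (Fin N)}
    (hs : G.IsCampSplit Vp Vm) (i r : Fin N) :
    Tendsto (fun t => campSign Vp i • predictor A h σ (x i) (u i) t -
      campSign Vp r • predictor A h σ (x r) (u r) t) atTop (𝓝 0) := by
  set z : Fin N → ℝ → Fin n → ℝ := fun i => predictor A h σ (x i) (u i) with hz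
  have hrule : ∀ i t, 0 ≤ t → u i t = F *ᵥ -∑ j, G.laplacian i j • z j t := by
    intro i t ht
    rw [hsol.rule i t ht, G.sum_abs_smul_sign_sub i fun j => predictor A h σ (x j) (u j) t]
  have hzc : ∀ i, ContinuousOn (z i) (Set.Ioi 0) := fun i =>
    continuousOn_predictor A hh σ (hsol.continuous_x i) (hsol.integrable_u i)
  have huc : ∀ i, ContinuousOn (u i) (Set.Ioi 0) := by
    intro i
    have hF' : Continuous fun v : Fin n → ℝ => F *ᵥ v :=
      continuous_const.matrix_mulVec continuous_id
    refine ContinuousOn.congr (f := fun t => F *ᵥ -∑ j, G.laplacian i j • z j t)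
      (hF'.comp_continuousOn ?_) fun t ht => hrule i t (le_of_lt ht)
    exact (continuousOn_finsetSum _ fun j _ => (hzc j).const_smul (G.laplacian i j)).neg
  have hder : ∀ i t, h < t → HasDerivAt (z i)
      (A *ᵥ z i t - (calA A h σ * F) *ᵥ ∑ j, G.laplacian i j • z j t) t := by
    intro i t ht
    have := hasDerivAt_predictor A hh σ (hsol.continuous_x i) (hsol.integrable_u i) (huc i)
      (hsol.dynamics i) ht
    refine this.congr_deriv ?_
    rw [hrule i t (hh.trans ht).le, Matrix.mulVec_mulVec, Matrix.mulVec_neg, ← sub_eq_add_neg]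
  -- The system is complexified because the eigenvalues of the Laplacian need not be real.
  have hder' : ∀ i t, h < t → HasDerivAt (fun t k => (z i t k : ℂ))
      (A.map (algebraMap ℝ ℂ) *ᵥ (fun k => (z i t k : ℂ)) -
        (calA A h σ * F).map (algebraMap ℝ ℂ) *ᵥ
          ∑ j, G.laplacian.map (algebraMap ℝ ℂ) i j • fun k => (z j t k : ℂ)) t := by
    intro i t ht
    have h1 : HasDerivAt (fun t k => (z i t k : ℂ)) (fun k =>
        ((A *ᵥ z i t - (calA A h σ * F) *ᵥ ∑ j, G.laplacian i j • z j t) k : ℂ)) t :=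
      hasDerivAt_pi.2 fun k => ((hasDerivAt_pi.1 (hder i t ht)) k).ofReal_comp
    refine h1.congr_deriv ?_
    have h2 : (∑ j, G.laplacian.map (algebraMap ℝ ℂ) i j • fun k => (z j t k : ℂ)) =
        fun k => ((∑ j, G.laplacian i j • z j t) k : ℂ) := by
      ext k; simp
    rw [h2, ← ofReal_mulVec, ← ofReal_mulVec]
    ext k; simp
  have hd : G.laplacian.map (algebraMap ℝ ℂ) *ᵥ (fun i => (campSign Vp i : ℂ)) = 0 := by
    rw [← ofReal_mulVec, hs.laplacian_mulVec_campSign]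
    ext; simp
  have hd0 : (fun i => (campSign Vp i : ℂ)) ≠ 0 := by
    intro h0
    have h1 : campSign Vp i = 0 := by simpa using congrFun h0 i
    simpa [h1] using campSign_mul_self Vp i
  have hφ : (Pi.single i (campSign Vp i : ℂ) - Pi.single r (campSign Vp r : ℂ)) ⬝ᵥ
      (fun i => (campSign Vp i : ℂ)) = 0 := by
    rw [sub_dotProduct, single_dotProduct, single_dotProduct, ← Complex.ofReal_mul,
      ← Complex.ofReal_mul, campSign_mul_self, campSign_mul_self, sub_self]
  have hlim := tendsto_combination_zero hd0 hd hF hder' hφ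
  rw [tendsto_pi_nhds] at hlim ⊢
  intro k
  have h1 := (Complex.continuous_re.tendsto 0).comp (hlim k)
  simpa [Function.comp_def, sub_mul, Finset.sum_sub_distrib, Pi.single_apply, ite_mul] using h1

/-- Under the memory communication rule the inputs vanish asymptotically. -/
theorem IsSolution.input_tendsto_zero {N n : ℕ} {G : SignedDigraph N}
    {A F : Matrix (Fin n) (Fin n) ℝ} {h σ : ℝ} (hh : 0 < h)
    (hF : ∀ l ∈ G.restEigenvalues, IsHurwitz (A.map (algebraMap ℝ ℂ) -
      l • (calA A h σ * F).map (algebraMap ℝ ℂ)))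
    {x u : Fin N → ℝ → Fin n → ℝ} (hsol : IsSolution G A F h σ x u) {Vp Vm : Set (Fin N)}
    (hs : G.IsCampSplit Vp Vm) (i : Fin N) : Tendsto (u i) atTop (𝓝 0) := by
  set z : Fin N → ℝ → Fin n → ℝ := fun i => predictor A h σ (x i) (u i) with hz
  have hLd : ∑ j, G.laplacian i j * campSign Vp j = 0 :=
    congrFun hs.laplacian_mulVec_campSign i
  -- Subtracting `d_i z_i` inside the sum changes nothing because `∑ j, L i j d_j = 0`, and `d_j *
  -- d_j = 1` restores `L i j z_j`.
  have h1 : Tendsto (fun t => F *ᵥ -∑ j, (G.laplacian i j * campSign Vp j) •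
      (campSign Vp j • z j t - campSign Vp i • z i t)) atTop (𝓝 0) := by
    have hc : Continuous fun v : Fin n → ℝ => F *ᵥ -v :=
      continuous_const.matrix_mulVec continuous_neg
    have hsum : Tendsto (fun t => ∑ j, (G.laplacian i j * campSign Vp j) •
        (campSign Vp j • z j t - campSign Vp i • z i t)) atTop (𝓝 0) := by
      simpa using tendsto_finsetSum Finset.univ fun j _ =>
        (hsol.predictor_consensus hh hF hs j i).const_smul (G.laplacian i j * campSign Vp j)
    simpa [Function.comp_def] using (hc.tendsto 0).comp hsum
  refine h1.congr' ?_
  filter_upwards [eventually_ge_atTop 0] with t ht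
  rw [hsol.rule i t ht, G.sum_abs_smul_sign_sub i fun j => predictor A h σ (x j) (u j) t]
  simp only [smul_sub, Finset.sum_sub_distrib]
  rw [← Finset.sum_smul, hLd, zero_smul, sub_zero]
  simp only [smul_smul, mul_assoc, campSign_mul_self, mul_one, hz]

end CoopetitiveOpinion

end

theorem theorem1 {N n : ℕ} (G : CoopetitiveOpinion.SignedDigraph N)
    (A : Matrix (Fin n) (Fin n) ℝ) (h σ : ℝ) (hh : 0 < h) (hσ0 : 0 ≤ σ) (hσ1 : σ ≤ 1)
    (hbal : G.StructurallyBalanced) (hconn : G.QuasiStronglyConnected)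
    (hA : CoopetitiveOpinion.ClassS A)
    (F : Matrix (Fin n) (Fin n) ℝ)
    (hF : ∀ l ∈ G.restEigenvalues,
      CoopetitiveOpinion.IsHurwitz
        (A.map (algebraMap ℝ ℂ) -
          l • (CoopetitiveOpinion.calA A h σ * F).map (algebraMap ℝ ℂ)))
    (x u : Fin N → ℝ → Fin n → ℝ)
    (hsol : CoopetitiveOpinion.IsSolution G A F h σ x u) :
    ∀ Vp Vm : Set (Fin N), G.IsCampSplit Vp Vm →
      CoopetitiveOpinion.EqualPolarization Vp Vm x := by
  intro Vp Vm hs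
  obtain ⟨r, -⟩ := hconn
  -- The signed predictor of one reference vertex is the common trajectory: `d_i x_i - xs = (d_i z_i
  -- - xs) - d_i (z_i - x_i)`.
  set xs : ℝ → Fin n → ℝ := fun t => CoopetitiveOpinion.campSign Vp r •
    CoopetitiveOpinion.predictor A h σ (x r) (u r) t with hxs
  have key : ∀ i, Tendsto (fun t => CoopetitiveOpinion.campSign Vp i • x i t - xs t)
      atTop (𝓝 0) := by
    intro i
    have h1 := hsol.predictor_consensus hh hF hs i r
    have h2 := (CoopetitiveOpinion.predictor_sub_tendsto_zero A hh σ (x i)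
      (hsol.input_tendsto_zero hh hF hs i)).const_smul (CoopetitiveOpinion.campSign Vp i)
    have h3 := h1.sub h2
    rw [smul_zero, sub_zero] at h3
    refine h3.congr fun t => ?_
    rw [hxs]
    module
  refine ⟨xs, fun i hi => ?_, fun j hj => ?_⟩
  · simpa [CoopetitiveOpinion.campSign, hi] using key i
  · have hjp : j ∉ Vp := fun hjp => by
      have : j ∈ Vp ∩ Vm := ⟨hjp, hj⟩
      simp [hs.inter_eq] at this
    have h1 := (key j).neg
    rw [neg_zero] at h1
    refine h1.congr fun t => ?_
    simp [CoopetitiveOpinion.campSign, hjp, add_comm]
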